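/- Let $A$ be a completely positive $n\times n$ matrix, i.e. $A=(\langle a_i,a_j\rangle)_{i,j\in[n]}$ for some entrywise nonnegative vectors $a_1,\dots,a_n\in\mathbb{R}^d_+$ and some $d\in\mathbb N$. Put $$S_A^{\mathrm{cp}}=\{\sqrt{A_{ii}}\,x_i-x_i^2: i\in[n]\}\cup\{A_{ij}-x_ix_j: 1\le i<j\le n\}\subseteq\mathbb{R}[x_1,\dots,x_n],$$ and $D(S_A^{\mathrm{cp}})=\{a\in\mathbb{R}^n: g(a)\ge 0\text{ for all }g\in S_A^{\mathrm{cp}}\}$. For $t\in\{1,2,\dots\}\cup\{\infty\}$ let $\mathbb{R}[\mathbf x]_{2t}$ be the space of real polynomials in $x_1,\dots,x_n$ of degree at most $2t$ (all polynomials if $t=\infty$), let $\mathcal M_{2t}(S_A^{\mathrm{cp}})$ be the cone generated by all polynomials $gp^2$ of degree at most $2t$ with $p\in\mathbb{R}[\mathbf x]$, $g\in S_A^{\mathrm{cp}}\cup\{1\}$, and define $$\xi_t^{\mathrm{cp}}(A)=\min\{L(1): L\in\mathbb{R}[\mathbf x]_{2t}^*,\ L(x_ix_j)=A_{ij}\ \text{for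 } i,j\in[n],\ L\ge 0\text{ on }\mathcal M_{2t}(S_A^{\mathrm{cp}})\}.$$ For $L\in\mathbb{R}[\mathbf x]_{2t}^*$ let $M_t(L)=(L(uv))_{u,v}$ be its moment matrix, indexed by the monomials $u,v$ of degree at most $t$, and $M(L)=M_\infty(L)$ if $t=\infty$. Let $\xi_*^{\mathrm{cp}}(A)$ be obtained by adding the constraint $\operatorname{rank}M(L)<\infty$ to the program defining $\xi_\infty^{\mathrm{cp}}(A)$. For $t<\infty$, $L$ is called flat if $\operatorname{rank}M_t(L)=\operatorname{rank}M_{t-\delta}(L)$ for some integer $1\le\delta\le t$, where $M_{t-\delta}(L)$ is the principal submatrix of $M_t(L)$ indexed by the monomials of degree at most $t-\delta$; for $t=\infty$, $L$ is called flat if $\operatorname{rank}M(L)<\infty$. Then: (i) for every $t\in\{1,2,\dots\}\cup\{\infty,*\}$ the optimum in $\xi_t^{\mathrm{cp}}(A)$ is attained; (ii) $\xi_t^{\mathrm{cp}}(A)\to\xi_\infty^{\mathrm{cp}}(A)=\xi_*^{\mathrm{cp}}(A)$ as $t\to\infty$; (iii) for $t\in\{1,2,\dots\}\cup\{\infty\}$,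 if the program defining $\xi_t^{\mathrm{cp}}(A)$ admits a flat optimal solution, then $\xi_t^{\mathrm{cp}}(A)=\xi_\infty^{\mathrm{cp}}(A)$; (iv) $\xi_\infty^{\mathrm{cp}}(A)=\xi_*^{\mathrm{cp}}(A)$ is the minimum value of $L(1)$ over all conic combinations $L=\sum_{k=1}^r c_k L_{a_k}$ ($r\in\mathbb{N}$, $c_k\ge 0$) of evaluations $L_{a_k}:p\mapsto p(a_k)$, $p\in\mathbb{R}[\mathbf x]$, at points $a_k\in D(S_A^{\mathrm{cp}})$, that satisfy $A=(L(x_ix_j))_{i,j\in[n]}$. -/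

import Mathlib

open Filter Topology

noncomputable section

namespace CPHierarchy

open MvPolynomial

/-- `A` is completely positive: `A = (⟨aᵢ, aⱼ⟩)` for entrywise nonnegative vectors
`a₁, …, aₙ` in some `ℝ^d` (the rows of `B`). -/
def IsCompletelyPositive {n : ℕ} (A : Matrix (Fin n) (Fin n) ℝ) : Prop :=
  ∃ (d : ℕ) (B : Matrix (Fin n) (Fin d) ℝ), (∀ i k, 0 ≤ B i k) ∧ A = B * B.transpose

/-- `ℝ[x₁, …, xₙ]_d`: the polynomials of total degree at most `d`, for `d ∈ ℕ ∪ {∞}`. -/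
def polyLE (n : ℕ) (d : ℕ∞) : Submodule ℝ (MvPolynomial (Fin n) ℝ) where
  carrier := {p | (p.totalDegree : ℕ∞) ≤ d}
  zero_mem' := by simp
  add_mem' {p q} hp hq := by
    have h : ((p + q).totalDegree : ℕ∞) ≤ (max p.totalDegree q.totalDegree : ℕ) :=
      Nat.cast_le.mpr (totalDegree_add p q)
    refine h.trans ?_
    rcases max_choice p.totalDegree q.totalDegree with h | h <;> rw [h] <;> assumption
  smul_mem' c p hp := by
    have h : ((c • p).totalDegree : ℕ∞) ≤ p.totalDegree :=
      Nat.cast_le.mpr (totalDegree_smul_le c p)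
    exact h.trans hp

theorem mem_polyLE {n : ℕ} {d : ℕ∞} {p : MvPolynomial (Fin n) ℝ} :
    p ∈ polyLE n d ↔ (p.totalDegree : ℕ∞) ≤ d := Iff.rfl

theorem one_mem_polyLE (n : ℕ) (d : ℕ∞) : (1 : MvPolynomial (Fin n) ℝ) ∈ polyLE n d := by
  simp [mem_polyLE]

/-- For `t ≥ 1` the products `xᵢ xⱼ` lie in `ℝ[x]_{2t}`. -/
theorem X_mul_X_mem_polyLE {n : ℕ} {t : ℕ∞} (ht : 1 ≤ t) (i j : Fin n) :
    (X i * X j : MvPolynomial (Fin n) ℝ) ∈ polyLE n (2 * t) := by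
  have h : (X i * X j : MvPolynomial (Fin n) ℝ).totalDegree ≤ 2 :=
    (totalDegree_mul _ _).trans (by simp [totalDegree_X])
  have h1 : ((X i * X j : MvPolynomial (Fin n) ℝ).totalDegree : ℕ∞) ≤ 2 := by exact_mod_cast h
  have h2 : (2 : ℕ∞) ≤ 2 * t := by simpa using mul_le_mul_right ht (2 : ℕ∞)
  exact mem_polyLE.mpr (h1.trans h2)

/-- The monomials (as exponent vectors) of degree at most `t`. -/
abbrev Mon (n : ℕ) (t : ℕ∞) : Type := {w : Fin n →₀ ℕ // (w.degree : ℕ∞) ≤ t}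

theorem monomial_mem_polyLE {n : ℕ} {t : ℕ∞} (u v : Mon n t) :
    monomial (u.1 + v.1) (1 : ℝ) ∈ polyLE n (2 * t) := by
  have h : (monomial (u.1 + v.1) (1 : ℝ)).totalDegree ≤ u.1.degree + v.1.degree := by
    rw [← map_add]
    exact totalDegree_monomial_le _ _
  have h1 : ((monomial (u.1 + v.1) (1 : ℝ)).totalDegree : ℕ∞) ≤ u.1.degree + v.1.degree := by
    exact_mod_cast h
  rw [mem_polyLE, two_mul]
  exact h1.trans (add_le_add u.2 v.2)

/-- The space `ℝ[x]_{2t}^*` of linear functionals on the polynomials of degree at most `2t`. -/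
abbrev TruncFunctional (n : ℕ) (t : ℕ∞) : Type := Module.Dual ℝ (polyLE n (2 * t))

/-- The value `L(1)`. -/
def mass {n : ℕ} {t : ℕ∞} (L : TruncFunctional n t) : ℝ := L ⟨1, one_mem_polyLE n _⟩

/-- The moment matrix `M_t(L) = (L(u v))`, indexed by the monomials of degree at most `t`. -/
def momentMatrix {n : ℕ} {t : ℕ∞} (L : TruncFunctional n t) : Matrix (Mon n t) (Mon n t) ℝ :=
  Matrix.of fun u v => L ⟨monomial (u.1 + v.1) 1, monomial_mem_polyLE u v⟩

/-- The principal submatrix of `M_t(L)` indexed by the monomials of degree at most `s`. -/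
def momentSubmatrix {n : ℕ} {t : ℕ∞} (L : TruncFunctional n t) (s : ℕ∞) :
    Matrix {u : Mon n t // (u.1.degree : ℕ∞) ≤ s} {u : Mon n t // (u.1.degree : ℕ∞) ≤ s} ℝ :=
  (momentMatrix L).submatrix Subtype.val Subtype.val

/-- Flatness: for finite `t`, `rank M_t(L) = rank M_{t-δ}(L)` for some `1 ≤ δ ≤ t`;
for `t = ∞`, `rank M(L) < ∞`. -/
def IsFlat {n : ℕ} {t : ℕ∞} (L : TruncFunctional n t) : Prop :=
  (t ≠ ⊤ ∧ ∃ δ : ℕ∞, 1 ≤ δ ∧ δ ≤ t ∧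
    (momentMatrix L).eRank = (momentSubmatrix L (t - δ)).eRank) ∨
  (t = ⊤ ∧ (momentMatrix L).eRank < ⊤)

/-- The truncated quadratic module `M_{2t}(S)`: the cone generated by the polynomials `g p²` of
degree at most `2t`, with `g ∈ S ∪ {1}`. -/
def quadraticModule {n : ℕ} (S : Set (MvPolynomial (Fin n) ℝ)) (t : ℕ∞) :
    PointedCone ℝ (MvPolynomial (Fin n) ℝ) :=
  PointedCone.hull ℝ {f | ∃ g ∈ S ∪ {1}, ∃ p, f = g * p ^ 2 ∧ (f.totalDegree : ℕ∞) ≤ 2 * t}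

/-- The localizing set
`{√Aᵢᵢ xᵢ - xᵢ² : i} ∪ {Aᵢⱼ - xᵢ xⱼ : i < j}`. -/
def localizingSet {n : ℕ} (A : Matrix (Fin n) (Fin n) ℝ) : Set (MvPolynomial (Fin n) ℝ) :=
  {g | ∃ i, g = C (Real.sqrt (A i i)) * X i - X i ^ 2} ∪
    {g | ∃ i j, i < j ∧ g = C (A i j) - X i * X j}

/-- The positivity domain `D(S)`. -/
def positivityDomain {n : ℕ} (S : Set (MvPolynomial (Fin n) ℝ)) : Set (Fin n → ℝ) :=
  {a | ∀ g ∈ S, 0 ≤ eval a g}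

/-- Feasibility of `L` for the program at level `t`. For `t ≥ 1` the membership hypothesis in
`moments` always holds, by `X_mul_X_mem_polyLE`. -/
structure IsFeasible {n : ℕ} (A : Matrix (Fin n) (Fin n) ℝ) {t : ℕ∞}
    (L : TruncFunctional n t) : Prop where
  moments : ∀ i j (h : (X i * X j : MvPolynomial (Fin n) ℝ) ∈ polyLE n (2 * t)),
    L ⟨X i * X j, h⟩ = A i j
  nonneg : ∀ p : polyLE n (2 * t),
    (p : MvPolynomial (Fin n) ℝ) ∈ quadraticModule (localizingSet A) t → 0 ≤ L p

/-- The objective values `L(1)` of the feasible solutions at level `t ∈ ℕ ∪ {∞}`. -/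
def values {n : ℕ} (A : Matrix (Fin n) (Fin n) ℝ) (t : ℕ∞) : Set ℝ :=
  {r | ∃ L : TruncFunctional n t, IsFeasible A L ∧ r = mass L}

/-- The objective values of the feasible solutions at level `∞` with `rank M(L) < ∞`. -/
def valuesStar {n : ℕ} (A : Matrix (Fin n) (Fin n) ℝ) : Set ℝ :=
  {r | ∃ L : TruncFunctional n ⊤, IsFeasible A L ∧ (momentMatrix L).eRank < ⊤ ∧ r = mass L}

/-- The bound `ξ_t^cp(A)`, for `t ∈ {1, 2, …} ∪ {∞}`. -/
def xi {n : ℕ} (A : Matrix (Fin n) (Fin n) ℝ) (t : ℕ∞) : ℝ := sInf (values A t)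

/-- The bound `ξ_*^cp(A)`. -/
def xiStar {n : ℕ} (A : Matrix (Fin n) (Fin n) ℝ) : ℝ := sInf (valuesStar A)

/-- `L` is a conic combination of evaluations at points of `D`. -/
def IsConicCombEval {n : ℕ} (D : Set (Fin n → ℝ)) (L : Module.Dual ℝ (MvPolynomial (Fin n) ℝ)) :
    Prop :=
  ∃ (r : ℕ) (c : Fin r → ℝ) (a : Fin r → Fin n → ℝ),
    (∀ k, 0 ≤ c k) ∧ (∀ k, a k ∈ D) ∧ ∀ p, L p = ∑ k, c k * eval (a k) p

/-- The values `L(1)` of the conic combinations `L` of evaluations at points of the positivity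
domain of `localizingSet A` that satisfy `A = (L(xᵢ xⱼ))`. -/
def conicValues {n : ℕ} (A : Matrix (Fin n) (Fin n) ℝ) : Set ℝ :=
  {r | ∃ L : Module.Dual ℝ (MvPolynomial (Fin n) ℝ),
    IsConicCombEval (positivityDomain (localizingSet A)) L ∧
    (∀ i j, L (X i * X j) = A i j) ∧ r = L 1}

end CPHierarchy

end

open CPHierarchy

/-! The polynomials `√Aᵢᵢ xᵢ - xᵢ²` make the quadratic module Archimedean with explicit constants: a
functional `F` nonnegative on it satisfies `|F p| ≤ polyBound A p * F 1` at every level that sees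
the degree of `p`. Feasible functionals of bounded mass therefore have pointwise limits along
ultrafilters (`exists_limit_functional`). A minimizing sequence then gives attainment, and optimal
solutions at levels `t → ∞` give convergence.

At level `∞` the key is that `F f ≥ 0` whenever `f ≥ 0` on the positivity domain
(`NonnegOn.nonneg_of_nonneg_on_domain`). The normalized functionals form a compact convex set. Its
extreme points are multiplicative, hence evaluations at points of the domain, and a linear
functional attains its minimum at an extreme point. Separating the quadratic moments from the convex
hull of the matrices `a aᵀ` then shows that every feasible mass is the mass of a conic combination
of evaluations (`mass_mem_conicValues`). Such combinations have finite rank, so the programs `∞`,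
`*` and the conic one have the same set of values. Complete positivity makes that set nonempty.

For a flat optimal solution, the polynomials modulo the kernel of the moment form carry commuting
multiplication operators, which extend the functional to all degrees (`exists_flat_extension`).
Modulo the kernel of the extension every polynomial has low degree, so positivity is inherited and
the extension is feasible at level `∞` with the same mass. -/

noncomputable section

namespace CPHierarchy

open MvPolynomial

/-! ### Truncated functionals as restrictions of functionals on all polynomials -/

/-- `F ≥ 0` on the generators `g p²` of degree at most `2t` of the truncated quadratic module. -/
def NonnegOn {n : ℕ} (S : Set (MvPolynomial (Fin n) ℝ)) (t : ℕ∞)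
    (F : Module.Dual ℝ (MvPolynomial (Fin n) ℝ)) : Prop :=
  ∀ g ∈ S ∪ {1}, ∀ p, ((g * p ^ 2).totalDegree : ℕ∞) ≤ 2 * t → 0 ≤ F (g * p ^ 2)

theorem NonnegOn.mono {n : ℕ} {S : Set (MvPolynomial (Fin n) ℝ)} {s t : ℕ∞}
    {F : Module.Dual ℝ (MvPolynomial (Fin n) ℝ)} (h : NonnegOn S t F) (hst : s ≤ t) :
    NonnegOn S s F :=
  fun g hg p hp => h g hg p (hp.trans (by gcongr))

theorem NonnegOn.sq {n : ℕ} {S : Set (MvPolynomial (Fin n) ℝ)} {t : ℕ∞}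
    {F : Module.Dual ℝ (MvPolynomial (Fin n) ℝ)} (h : NonnegOn S t F)
    (p : MvPolynomial (Fin n) ℝ) (hp : ((p ^ 2).totalDegree : ℕ∞) ≤ 2 * t) : 0 ≤ F (p ^ 2) := by
  simpa using h 1 (Or.inr rfl) p (by simpa using hp)

theorem NonnegOn.hull_nonneg {n : ℕ} {S : Set (MvPolynomial (Fin n) ℝ)} {t : ℕ∞}
    {F : Module.Dual ℝ (MvPolynomial (Fin n) ℝ)} (h : NonnegOn S t F)
    {p : MvPolynomial (Fin n) ℝ} (hp : p ∈ quadraticModule S t) : 0 ≤ F p := by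
  refine Submodule.span_induction (p := fun p _ => 0 ≤ F p) ?_ (by simp) ?_ ?_ hp
  · rintro _ ⟨g, hg, p, rfl, hd⟩
    exact h g hg p hd
  · intro x y _ _ hx hy
    rw [map_add]
    exact add_nonneg hx hy
  · intro c x _ hx
    have : c • x = (c : ℝ) • x := rfl
    rw [this, map_smul]
    exact mul_nonneg c.2 hx

theorem isFeasible_domRestrict {n : ℕ} {A : Matrix (Fin n) (Fin n) ℝ} {t : ℕ∞}
    {F : Module.Dual ℝ (MvPolynomial (Fin n) ℝ)} (h : NonnegOn (localizingSet A) t F)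
    (hm : ∀ i j, F (X i * X j) = A i j) :
    IsFeasible A (t := t) (F.domRestrict (polyLE n (2 * t))) where
  moments i j _ := hm i j
  nonneg _ hp := h.hull_nonneg hp

/-- An arbitrary linear extension suffices: all the constraints concern degree at most `2t`, and
nothing is claimed about `F` above it. This removes the subtype `polyLE` from later arguments. -/
theorem IsFeasible.exists_extend {n : ℕ} {A : Matrix (Fin n) (Fin n) ℝ} {t : ℕ∞}
    {L : TruncFunctional n t} (hL : IsFeasible A L) (ht : 1 ≤ t) :
    ∃ F : Module.Dual ℝ (MvPolynomial (Fin n) ℝ), F.domRestrict (polyLE n (2 * t)) = L ∧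
      NonnegOn (localizingSet A) t F ∧ ∀ i j, F (X i * X j) = A i j := by
  obtain ⟨F, hF⟩ := LinearMap.exists_extend L
  have hF' : ∀ p : polyLE n (2 * t), F p = L p := fun p => LinearMap.congr_fun hF p
  refine ⟨F, hF, fun g hg p hp => ?_, fun i j => ?_⟩
  · have := hF' ⟨g * p ^ 2, hp⟩
    rw [this]
    exact hL.nonneg _ (Submodule.subset_span ⟨g, hg, p, rfl, hp⟩)
  · have := hF' ⟨X i * X j, X_mul_X_mem_polyLE ht i j⟩
    rw [this]
    exact hL.moments i j _

theorem mem_values_iff {n : ℕ} {A : Matrix (Fin n) (Fin n) ℝ} {t : ℕ∞} (ht : 1 ≤ t) {r : ℝ} :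
    r ∈ values A t ↔ ∃ F : Module.Dual ℝ (MvPolynomial (Fin n) ℝ),
      NonnegOn (localizingSet A) t F ∧ (∀ i j, F (X i * X j) = A i j) ∧ r = F 1 := by
  constructor
  · rintro ⟨L, hL, rfl⟩
    obtain ⟨F, rfl, h1, h2⟩ := hL.exists_extend ht
    exact ⟨F, h1, h2, rfl⟩
  · rintro ⟨F, h1, h2, rfl⟩
    exact ⟨_, isFeasible_domRestrict h1 h2, rfl⟩

theorem NonnegOn.one_nonneg {n : ℕ} {S : Set (MvPolynomial (Fin n) ℝ)} {t : ℕ∞}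
    {F : Module.Dual ℝ (MvPolynomial (Fin n) ℝ)} (h : NonnegOn S t F) : 0 ≤ F 1 := by
  simpa using h.sq 1 (by simp)

/-! ### Archimedean bounds on moments -/

/-- A bound on all the coordinates over the positivity domain of `localizingSet A`. -/
def coordBound {n : ℕ} (A : Matrix (Fin n) (Fin n) ℝ) : ℝ := 1 + ∑ i, √(A i i) ^ 2

theorem one_le_coordBound {n : ℕ} (A : Matrix (Fin n) (Fin n) ℝ) : 1 ≤ coordBound A :=
  le_add_of_nonneg_right (Finset.sum_nonneg fun _ _ => sq_nonneg _)

theorem sq_sqrt_le_coordBound {n : ℕ} (A : Matrix (Fin n) (Fin n) ℝ) (i : Fin n) :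
    √(A i i) ^ 2 ≤ coordBound A := by
  have := Finset.single_le_sum (f := fun i => √(A i i) ^ 2) (fun _ _ => sq_nonneg _)
    (Finset.mem_univ i)
  simp only [coordBound]
  linarith

theorem degree_le_of_sq {n : ℕ} {t : ℕ∞} {p : MvPolynomial (Fin n) ℝ}
    (h : (p.totalDegree : ℕ∞) ≤ t) : ((p ^ 2).totalDegree : ℕ∞) ≤ 2 * t :=
  calc ((p ^ 2).totalDegree : ℕ∞) ≤ ((2 * p.totalDegree : ℕ) : ℕ∞) := by
        exact_mod_cast totalDegree_pow p 2
    _ ≤ 2 * t := by push_cast; gcongr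

theorem degree_mul_sq_le {n : ℕ} {t : ℕ∞} {g p : MvPolynomial (Fin n) ℝ}
    (hg : g.totalDegree ≤ 2) (h : ((p.totalDegree + 1 : ℕ) : ℕ∞) ≤ t) :
    ((g * p ^ 2).totalDegree : ℕ∞) ≤ 2 * t := by
  have h1 : (g * p ^ 2).totalDegree ≤ 2 * (p.totalDegree + 1) := by
    have := totalDegree_mul g (p ^ 2)
    have := totalDegree_pow p 2
    omega
  calc ((g * p ^ 2).totalDegree : ℕ∞) ≤ ((2 * (p.totalDegree + 1) : ℕ) : ℕ∞) := by
        exact_mod_cast h1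
    _ ≤ 2 * t := by rw [Nat.cast_mul]; exact mul_le_mul_right h 2

theorem totalDegree_le_two_of_mem {n : ℕ} {A : Matrix (Fin n) (Fin n) ℝ}
    {g : MvPolynomial (Fin n) ℝ} (hg : g ∈ localizingSet A ∪ {1}) : g.totalDegree ≤ 2 := by
  rcases hg with (⟨i, rfl⟩ | ⟨i, j, _, rfl⟩) | rfl
  · refine (totalDegree_sub _ _).trans (max_le ?_ ?_)
    · exact (totalDegree_mul _ _).trans (by simp [totalDegree_X])
    · exact (totalDegree_pow _ _).trans (by simp [totalDegree_X])
  · refine (totalDegree_sub _ _).trans (max_le (by simp) ?_)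
    exact (totalDegree_mul _ _).trans (by simp [totalDegree_X])
  · simp

/-- `(Aᵢᵢ - xᵢ²) p² = (√Aᵢᵢ - xᵢ)² p² + 2 (√Aᵢᵢ xᵢ - xᵢ²) p²`. -/
theorem NonnegOn.X_sq_mul_sq_le {n : ℕ} {A : Matrix (Fin n) (Fin n) ℝ} {t : ℕ∞}
    {F : Module.Dual ℝ (MvPolynomial (Fin n) ℝ)} (h : NonnegOn (localizingSet A) t F) (i : Fin n)
    (p : MvPolynomial (Fin n) ℝ) (hp : ((p.totalDegree + 1 : ℕ) : ℕ∞) ≤ t) :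
    F ((X i * p) ^ 2) ≤ √(A i i) ^ 2 * F (p ^ 2) := by
  have h1 := h _ (Or.inl (Or.inl ⟨i, rfl⟩)) p
    (degree_mul_sq_le (totalDegree_le_two_of_mem (Or.inl (Or.inl ⟨i, rfl⟩))) hp)
  have h2 := h.sq ((C √(A i i) - X i) * p) (degree_le_of_sq (le_trans (by
    have h3 : (C √(A i i) - X i : MvPolynomial (Fin n) ℝ).totalDegree ≤ 1 :=
      (totalDegree_sub _ _).trans (by simp [totalDegree_X])
    have := totalDegree_mul (C √(A i i) - X i) p
    exact_mod_cast (by omega : _ ≤ p.totalDegree + 1)) hp))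
  have e : (√(A i i) ^ 2) • p ^ 2 - (X i * p) ^ 2 = ((C √(A i i) - X i) * p) ^ 2 +
      (2 : ℝ) • ((C √(A i i) * X i - X i ^ 2) * p ^ 2) := by
    simp only [smul_eq_C_mul, C_pow, map_ofNat]
    ring
  have := congrArg F e
  simp only [map_sub, map_add, map_smul, smul_eq_mul] at this
  linarith

theorem exists_single_add {σ : Type*} {w : σ →₀ ℕ} (hw : w.degree ≠ 0) :
    ∃ (i : σ) (v : σ →₀ ℕ), w = Finsupp.single i 1 + v := by
  obtain ⟨i, hi⟩ : ∃ i, w i ≠ 0 := by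
    by_contra! hc
    exact hw (by rw [show w = 0 from Finsupp.ext hc, map_zero])
  exact ⟨i, w - Finsupp.single i 1, (add_tsub_cancel_of_le (by
    rw [Finsupp.single_le_iff]; omega)).symm⟩

theorem NonnegOn.monomial_sq_le {n : ℕ} {A : Matrix (Fin n) (Fin n) ℝ} {t : ℕ∞}
    {F : Module.Dual ℝ (MvPolynomial (Fin n) ℝ)} (h : NonnegOn (localizingSet A) t F) :
    ∀ (d : ℕ) (w : Fin n →₀ ℕ), w.degree = d → (d : ℕ∞) ≤ t →
    F (monomial w 1 ^ 2) ≤ coordBound A ^ d * F 1 := by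
  intro d
  induction d with
  | zero =>
    intro w hw _
    rw [(Finsupp.degree_eq_zero_iff w).mp hw]
    simp
  | succ d ih =>
    intro w hw hd
    obtain ⟨i, v, rfl⟩ := exists_single_add (w := w) (by omega)
    have hv : v.degree = d := by
      rw [map_add, Finsupp.degree_single] at hw
      omega
    have e : monomial (Finsupp.single i 1 + v) (1 : ℝ) = X i * monomial v 1 := by
      rw [X, monomial_mul, one_mul]
    have hv2 : ((monomial v (1 : ℝ)).totalDegree + 1 : ℕ) ≤ d + 1 := by
      have : _ ≤ v.degree := totalDegree_monomial_le v (1 : ℝ)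
      omega
    have h1 := h.X_sq_mul_sq_le i (monomial v 1) (le_trans (by exact_mod_cast hv2) hd)
    have h2 := ih v hv (le_trans (by exact_mod_cast Nat.le_succ d) hd)
    have h0 : 0 ≤ F (monomial v 1 ^ 2) := h.sq _ (degree_le_of_sq (le_trans (by
      exact_mod_cast (by omega : _ ≤ d + 1)) hd))
    rw [e]
    calc _ ≤ _ := h1
      _ ≤ coordBound A * (coordBound A ^ d * F 1) := by
        have := one_le_coordBound A
        exact mul_le_mul (sq_sqrt_le_coordBound A i) h2 h0 (by linarith)
      _ = _ := by ring

theorem exists_degree_split {σ : Type*} {w : σ →₀ ℕ} {t : ℕ∞} (hw : (w.degree : ℕ∞) ≤ 2 * t) :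
    ∃ u v : σ →₀ ℕ, w = u + v ∧ (u.degree : ℕ∞) ≤ t ∧ (v.degree : ℕ∞) ≤ t := by
  -- The two parts have degrees `⌊d/2⌋` and `⌈d/2⌉`. Rounding up is harmless because the bound `2t`
  -- is even, whence the slack `2 * a ≤ b + 1` in `half`.
  obtain ⟨u, hu, hud⟩ := Finsupp.exists_le_degree_eq w (w.degree / 2) (by omega)
  obtain ⟨v, rfl⟩ : ∃ v, w = u + v := ⟨w - u, (add_tsub_cancel_of_le hu).symm⟩
  rw [map_add] at hud
  have half : ∀ a b : ℕ, ((b : ℕ) : ℕ∞) ≤ 2 * t → 2 * a ≤ b + 1 → (a : ℕ∞) ≤ t := by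
    intro a b hb hab
    cases t with
    | top => exact le_top
    | coe t =>
      have : b ≤ 2 * t := by exact_mod_cast hb
      exact_mod_cast (by omega : a ≤ t)
  refine ⟨u, v, rfl, half _ _ hw (by rw [map_add]; omega), half _ _ hw (by rw [map_add]; omega)⟩

/-- Split the monomial as `u v` with both degrees at most `t`. Nonnegativity of `F` on `(u ± v)²`
gives `2 |F(u v)| ≤ F(u²) + F(v²)`. -/
theorem NonnegOn.abs_monomial_le {n : ℕ} {A : Matrix (Fin n) (Fin n) ℝ} {t : ℕ∞}
    {F : Module.Dual ℝ (MvPolynomial (Fin n) ℝ)} (h : NonnegOn (localizingSet A) t F)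
    (w : Fin n →₀ ℕ) (hw : (w.degree : ℕ∞) ≤ 2 * t) :
    |F (monomial w 1)| ≤ coordBound A ^ w.degree * F 1 := by
  obtain ⟨u, v, rfl, hu', hv'⟩ := exists_degree_split hw
  have bd : ∀ z : Fin n →₀ ℕ, (z.degree : ℕ∞) ≤ t → z.degree ≤ (u + v).degree →
      F (monomial z 1 ^ 2) ≤ coordBound A ^ (u + v).degree * F 1 := fun z hz hz' =>
    (h.monomial_sq_le _ z rfl hz).trans (mul_le_mul_of_nonneg_right
      (pow_le_pow_right₀ (one_le_coordBound A) hz') h.one_nonneg)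
  have b1 := bd u hu' (by simp)
  have b2 := bd v hv' (by simp)
  have dg : ∀ z : Fin n →₀ ℕ, (z.degree : ℕ∞) ≤ t → ((monomial z (1 : ℝ)).totalDegree : ℕ∞) ≤ t :=
    fun z hz => le_trans (by exact_mod_cast totalDegree_monomial_le z (1 : ℝ)) hz
  have hp := h.sq (monomial u 1 + monomial v 1) (degree_le_of_sq
    ((polyLE n t).add_mem (dg u hu') (dg v hv')))
  have hm := h.sq (monomial u 1 - monomial v 1) (degree_le_of_sq
    ((polyLE n t).sub_mem (dg u hu') (dg v hv')))
  have e : monomial (u + v) (1 : ℝ) = monomial u 1 * monomial v 1 := by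
    rw [monomial_mul, one_mul]
  have e1 := congrArg F (show (monomial u (1 : ℝ) + monomial v 1) ^ 2 =
    monomial u 1 ^ 2 + (2 : ℝ) • (monomial u 1 * monomial v 1) + monomial v 1 ^ 2 by
      rw [smul_eq_C_mul, map_ofNat]; ring)
  have e2 := congrArg F (show (monomial u (1 : ℝ) - monomial v 1) ^ 2 =
    monomial u 1 ^ 2 - (2 : ℝ) • (monomial u 1 * monomial v 1) + monomial v 1 ^ 2 by
      rw [smul_eq_C_mul, map_ofNat]; ring)
  simp only [map_sub, map_add, map_smul, smul_eq_mul] at e1 e2 b1 b2 ⊢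
  rw [e, abs_le]
  constructor <;> linarith

/-- The constant in the bound `|F p| ≤ polyBound A p * F 1`. -/
def polyBound {n : ℕ} (A : Matrix (Fin n) (Fin n) ℝ) (p : MvPolynomial (Fin n) ℝ) : ℝ :=
  ∑ w ∈ p.support, |coeff w p| * coordBound A ^ w.degree

theorem polyBound_nonneg {n : ℕ} (A : Matrix (Fin n) (Fin n) ℝ) (p : MvPolynomial (Fin n) ℝ) :
    0 ≤ polyBound A p :=
  Finset.sum_nonneg fun _ _ => mul_nonneg (abs_nonneg _)
    (pow_nonneg (by linarith [one_le_coordBound A]) _)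

theorem NonnegOn.abs_le {n : ℕ} {A : Matrix (Fin n) (Fin n) ℝ} {t : ℕ∞}
    {F : Module.Dual ℝ (MvPolynomial (Fin n) ℝ)} (h : NonnegOn (localizingSet A) t F)
    {p : MvPolynomial (Fin n) ℝ} (hp : (p.totalDegree : ℕ∞) ≤ 2 * t) :
    |F p| ≤ polyBound A p * F 1 := by
  have e : F p = ∑ w ∈ p.support, coeff w p * F (monomial w 1) := by
    conv_lhs => rw [p.as_sum]
    rw [map_sum]
    refine Finset.sum_congr rfl fun w _ => ?_
    rw [← smul_eq_mul, ← map_smul, smul_monomial, smul_eq_mul, mul_one]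
  rw [e, polyBound, Finset.sum_mul]
  refine (Finset.abs_sum_le_sum_abs _ _).trans (Finset.sum_le_sum fun w hw => ?_)
  rw [abs_mul, mul_assoc]
  refine mul_le_mul_of_nonneg_left (h.abs_monomial_le w (le_trans ?_ hp)) (abs_nonneg _)
  have := le_totalDegree hw
  rw [Finsupp.degree_eq_sum]
  rw [Finsupp.sum_fintype _ _ (by simp)] at this
  exact_mod_cast this

/-! ### Compactness: attainment and convergence -/

/-- Pointwise limits of feasible functionals along an ultrafilter are feasible. -/
theorem exists_limit_functional {n : ℕ} {A : Matrix (Fin n) (Fin n) ℝ} {ι : Type*}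
    (U : Ultrafilter ι) (τ : ι → ℕ∞) (t : ℕ∞)
    (hτ : ∀ m : ℕ, (m : ℕ∞) ≤ 2 * t → ∀ᶠ k in U, (m : ℕ∞) ≤ 2 * τ k) (ht : 1 ≤ t)
    (F : ι → Module.Dual ℝ (MvPolynomial (Fin n) ℝ))
    (hF : ∀ᶠ k in U, NonnegOn (localizingSet A) (τ k) (F k))
    (hm : ∀ᶠ k in U, ∀ i j, F k (X i * X j) = A i j) {c : ℝ} (hc : ∀ᶠ k in U, F k 1 ≤ c) :
    ∃ r ∈ values A t, Tendsto (fun k => F k 1) U (𝓝 r) := by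
  -- Once the level `τ k` covers the degree of `p`, the values `F k p` stay in one compact interval,
  -- so they converge along the ultrafilter.
  have hlim : ∀ p : polyLE n (2 * t), ∃ y : ℝ, Tendsto (fun k => F k p) U (𝓝 y) := by
    intro p
    have hK : IsCompact (Set.Icc (-(polyBound A p * c)) (polyBound A p * c)) := isCompact_Icc
    obtain ⟨y, _, hy⟩ := hK.ultrafilter_le_nhds (U.map fun k => F k p) (by
      rw [le_principal_iff]
      change ∀ᶠ k in U, F k p ∈ Set.Icc (-(polyBound A p * c)) (polyBound A p * c)
      filter_upwards [hτ _ p.2, hF, hc] with k h1 h2 h3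
      have := (h2.abs_le h1).trans (mul_le_mul_of_nonneg_left h3 (polyBound_nonneg A _))
      exact abs_le.mp this)
    exact ⟨y, hy⟩
  choose y hy using hlim
  let L : TruncFunctional n t :=
    { toFun := y
      map_add' := fun p q => tendsto_nhds_unique (hy (p + q)) (by
        simpa using (hy p).add (hy q))
      map_smul' := fun a p => tendsto_nhds_unique (hy (a • p)) (by
        simpa using (hy p).const_mul a) }
  refine ⟨mass L, ?_, hy ⟨1, one_mem_polyLE n _⟩⟩
  obtain ⟨G, hG⟩ := LinearMap.exists_extend L
  have hG' : ∀ p : polyLE n (2 * t), G p = y p := fun p => LinearMap.congr_fun hG p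
  refine (mem_values_iff ht).mpr ⟨G, fun g hg p hp => ?_, fun i j => ?_, (hG' _).symm⟩
  · rw [hG' ⟨g * p ^ 2, hp⟩]
    refine ge_of_tendsto (hy ⟨g * p ^ 2, hp⟩) ?_
    filter_upwards [hτ _ hp, hF] with k h1 h2
    exact h2 g hg p h1
  · rw [hG' ⟨X i * X j, X_mul_X_mem_polyLE ht i j⟩]
    refine tendsto_nhds_unique (hy ⟨X i * X j, X_mul_X_mem_polyLE ht i j⟩) ?_
    refine tendsto_const_nhds.congr' ?_
    filter_upwards [hm] with k h
    exact (h i j).symm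

theorem values_bddBelow {n : ℕ} (A : Matrix (Fin n) (Fin n) ℝ) {t : ℕ∞} (ht : 1 ≤ t) :
    BddBelow (values A t) := by
  refine ⟨0, fun r hr => ?_⟩
  obtain ⟨F, h1, _, rfl⟩ := (mem_values_iff ht).mp hr
  exact h1.one_nonneg

theorem isLeast_xi {n : ℕ} {A : Matrix (Fin n) (Fin n) ℝ} {t : ℕ∞} (ht : 1 ≤ t)
    (hne : (values A t).Nonempty) : IsLeast (values A t) (xi A t) := by
  refine ⟨?_, fun r hr => csInf_le (values_bddBelow A ht) hr⟩
  obtain ⟨u, -, hu, hmem⟩ := exists_seq_tendsto_sInf hne (values_bddBelow A ht)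
  choose F hF hm hr using fun k => (mem_values_iff ht).mp (hmem k)
  have hlim : Tendsto u (hyperfilter ℕ) (𝓝 (xi A t)) :=
    hu.mono_left Nat.hyperfilter_le_atTop
  obtain ⟨r, hr', hr2⟩ := exists_limit_functional (hyperfilter ℕ) (fun _ => t) t
    (fun m hm => Eventually.of_forall fun _ => hm) ht F (Eventually.of_forall hF)
    (Eventually.of_forall hm) (c := xi A t + 1) (by
      filter_upwards [hlim.eventually (gt_mem_nhds (lt_add_one _))] with k hk
      rw [← hr k]
      exact hk.le)
  have : r = xi A t := tendsto_nhds_unique hr2 (by simpa only [← hr] using hlim)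
  rwa [← this]

theorem values_anti {n : ℕ} (A : Matrix (Fin n) (Fin n) ℝ) {s t : ℕ∞} (hs : 1 ≤ s)
    (hst : s ≤ t) : values A t ⊆ values A s := by
  intro r hr
  obtain ⟨F, h1, h2, rfl⟩ := (mem_values_iff (hs.trans hst)).mp hr
  exact (mem_values_iff hs).mpr ⟨F, h1.mono hst, h2, rfl⟩

theorem xi_mono {n : ℕ} {A : Matrix (Fin n) (Fin n) ℝ} {s t : ℕ∞} (hs : 1 ≤ s) (hst : s ≤ t)
    (hne : (values A t).Nonempty) : xi A s ≤ xi A t :=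
  csInf_le_csInf (values_bddBelow A hs) hne (values_anti A hs hst)

theorem tendsto_xi {n : ℕ} {A : Matrix (Fin n) (Fin n) ℝ} (hne : (values A ⊤).Nonempty) :
    Tendsto (fun t : ℕ => xi A (t : ℕ∞)) atTop (𝓝 (xi A ⊤)) := by
  rw [tendsto_iff_ultrafilter]
  intro U hU
  have hge : ∀ m : ℕ, ∀ᶠ k in U, m ≤ k := fun m => hU (eventually_ge_atTop m)
  have hle : ∀ k : ℕ, 1 ≤ k → xi A (k : ℕ∞) ≤ xi A ⊤ := fun k hk =>
    xi_mono (by exact_mod_cast hk) le_top hne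
  have hex : ∀ k : ℕ, ∃ F : Module.Dual ℝ (MvPolynomial (Fin n) ℝ), 1 ≤ k →
      NonnegOn (localizingSet A) k F ∧ (∀ i j, F (X i * X j) = A i j) ∧
        xi A (k : ℕ∞) = F 1 := by
    intro k
    by_cases hk : 1 ≤ k
    · have hk' : (1 : ℕ∞) ≤ k := by exact_mod_cast hk
      obtain ⟨F, hF⟩ := (mem_values_iff hk').mp
        (isLeast_xi hk' (hne.mono (values_anti A hk' le_top))).1
      exact ⟨F, fun _ => hF⟩
    -- Level `0` is irrelevant to the limit; the zero functional only fills the place.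
    · exact ⟨0, fun h => absurd h hk⟩
  choose F hF using hex
  obtain ⟨r, hr, hr2⟩ := exists_limit_functional U (fun k : ℕ => (k : ℕ∞)) ⊤
    (fun m _ => (hge m).mono fun k hk => by exact_mod_cast (by omega : m ≤ 2 * k)) le_top F
    ((hge 1).mono fun k hk => (hF k hk).1) ((hge 1).mono fun k hk => (hF k hk).2.1)
    (c := xi A ⊤) ((hge 1).mono fun k hk => (hF k hk).2.2 ▸ hle k hk)
  have hr3 : Tendsto (fun k : ℕ => xi A (k : ℕ∞)) U (𝓝 r) :=
    hr2.congr' ((hge 1).mono fun k hk => ((hF k hk).2.2).symm)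
  have h1 : xi A ⊤ ≤ r := csInf_le (values_bddBelow A le_top) hr
  have h2 : r ≤ xi A ⊤ := le_of_tendsto hr3 ((hge 1).mono hle)
  rwa [le_antisymm h1 h2]

/-! ### Positivity on the domain through extreme points -/

theorem NonnegOn.cauchy_schwarz {n : ℕ} {S : Set (MvPolynomial (Fin n) ℝ)}
    {F : Module.Dual ℝ (MvPolynomial (Fin n) ℝ)} (h : NonnegOn S ⊤ F)
    {g : MvPolynomial (Fin n) ℝ} (hg : g ∈ S ∪ {1}) (u v : MvPolynomial (Fin n) ℝ) :
    F (g * (u * v)) ^ 2 ≤ F (g * u ^ 2) * F (g * v ^ 2) := by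
  have key : ∀ s : ℝ, 0 ≤ F (g * v ^ 2) * (s * s) + (2 * F (g * (u * v))) * s + F (g * u ^ 2) := by
    intro s
    have h1 := h g hg (u + C s * v) (by simp)
    have e := congrArg F (show g * (u + C s * v) ^ 2 = (s * s) • (g * v ^ 2) +
      (2 * s) • (g * (u * v)) + g * u ^ 2 by
        simp only [smul_eq_C_mul, C_mul, map_ofNat]; ring)
    simp only [map_add, map_smul, smul_eq_mul] at e
    linarith
  have := discrim_le_zero key
  rw [discrim] at this
  nlinarith

/-- A log-convex sequence of growth at most `N ^ k` satisfies `a₁ ≤ N a₀`. -/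
theorem le_mul_of_log_convex {a : ℕ → ℝ} {c N : ℝ} (hN : 0 < N) (h0 : ∀ k, 0 ≤ a k)
    (hlc : ∀ k, a (k + 1) ^ 2 ≤ a k * a (k + 2)) (hb : ∀ k, a k ≤ c * N ^ k) :
    a 1 ≤ N * a 0 := by
  by_contra! hlt
  have ha0 : 0 < a 0 := by
    rcases (h0 0).lt_or_eq with h | h
    · exact h
    · have := hlc 0
      rw [← h] at this hlt
      nlinarith
  -- Log-convexity makes the successive ratios nondecreasing, so `a k ≥ ρ ^ k * a 0` with `ρ > N`,
  -- which outgrows `c * N ^ k`.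
  set ρ := a 1 / a 0 with hρ
  have hρN : N < ρ := by rwa [hρ, lt_div_iff₀ ha0]
  have hρ0 : 0 < ρ := hN.trans hρN
  have step : ∀ k, 0 < a k ∧ ρ * a k ≤ a (k + 1) := by
    intro k
    induction k with
    | zero => exact ⟨ha0, by rw [hρ, div_mul_cancel₀ _ ha0.ne']⟩
    | succ k ih =>
      have h1 : 0 < a (k + 1) := lt_of_lt_of_le (mul_pos hρ0 ih.1) ih.2
      refine ⟨h1, ?_⟩
      have h2 := hlc k
      have h3 : a k * (ρ * a (k + 1)) ≤ a k * a (k + 2) := by nlinarith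
      exact le_of_mul_le_mul_left h3 ih.1
  have hpow : ∀ k, ρ ^ k * a 0 ≤ a k := by
    intro k
    induction k with
    | zero => simp
    | succ k ih =>
      calc ρ ^ (k + 1) * a 0 = ρ * (ρ ^ k * a 0) := by ring
        _ ≤ ρ * a k := mul_le_mul_of_nonneg_left ih hρ0.le
        _ ≤ _ := (step k).2
  obtain ⟨k, hk⟩ := pow_unbounded_of_one_lt (c / a 0) ((one_lt_div hN).mpr hρN)
  rw [div_pow, div_lt_div_iff₀ ha0 (pow_pos hN k)] at hk
  linarith [hpow k, hb k]

/-- Transfers the bound `q² ≤ N` from squares to the weight `g`; this is not immediate, as products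
of constraints need not lie in the quadratic module. The sequence `F (g (q^k p)²)` is log-convex by
Cauchy–Schwarz with weight `g`, and Cauchy–Schwarz with weight `1` bounds it by a multiple of `N ^
k`. -/
theorem NonnegOn.sq_mul_le {n : ℕ} {S : Set (MvPolynomial (Fin n) ℝ)}
    {F : Module.Dual ℝ (MvPolynomial (Fin n) ℝ)} (h : NonnegOn S ⊤ F)
    {q : MvPolynomial (Fin n) ℝ} {N : ℝ} (hN : 0 < N)
    (hq : ∀ p, F ((q * p) ^ 2) ≤ N * F (p ^ 2))
    {g : MvPolynomial (Fin n) ℝ} (hg : g ∈ S ∪ {1}) (p : MvPolynomial (Fin n) ℝ) :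
    F (q ^ 2 * (g * p ^ 2)) ≤ N * F (g * p ^ 2) := by
  have hpow : ∀ m, F ((q ^ m) ^ 2) ≤ N ^ m * F 1 := by
    intro m
    induction m with
    | zero => simp
    | succ m ih =>
      calc F ((q ^ (m + 1)) ^ 2) = F ((q * q ^ m) ^ 2) := by rw [pow_succ' q m]
        _ ≤ N * F ((q ^ m) ^ 2) := hq _
        _ ≤ N * (N ^ m * F 1) := mul_le_mul_of_nonneg_left ih hN.le
        _ = _ := by ring
  have h1 : 0 ≤ F 1 := h.one_nonneg
  have hs : 0 ≤ F ((g * p ^ 2) ^ 2) := h.sq _ (by simp)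
  have := le_mul_of_log_convex (a := fun k => F (g * (q ^ k * p) ^ 2))
    (c := √(F 1 * F ((g * p ^ 2) ^ 2))) hN (fun k => h g hg _ (by simp)) ?_ ?_
  · have e : q ^ 2 * (g * p ^ 2) = g * (q ^ 1 * p) ^ 2 := by ring
    have e' : g * p ^ 2 = g * (q ^ 0 * p) ^ 2 := by ring
    rw [e, e']
    exact this
  · intro k
    have e : g * (q ^ (k + 1) * p) ^ 2 = g * ((q ^ k * p) * (q ^ (k + 2) * p)) := by ring
    rw [e]
    exact h.cauchy_schwarz hg _ _
  · intro k
    have h2 := h.cauchy_schwarz (Or.inr rfl) (q ^ (2 * k)) (g * p ^ 2)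
    have e : (1 : MvPolynomial (Fin n) ℝ) * (q ^ (2 * k) * (g * p ^ 2)) =
      g * (q ^ k * p) ^ 2 := by ring
    rw [e, one_mul, one_mul] at h2
    have h3 : F (g * (q ^ k * p) ^ 2) ^ 2 ≤ (√(F 1 * F ((g * p ^ 2) ^ 2)) * N ^ k) ^ 2 := by
      rw [mul_pow (√_), Real.sq_sqrt (mul_nonneg h1 hs)]
      calc _ ≤ _ := h2
        _ ≤ N ^ (2 * k) * F 1 * F ((g * p ^ 2) ^ 2) := mul_le_mul_of_nonneg_right (hpow _) hs
        _ = _ := by ring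
    exact le_of_sq_le_sq h3 (by positivity)

theorem NonnegOn.eq_zero_of_one {n : ℕ} {A : Matrix (Fin n) (Fin n) ℝ}
    {F : Module.Dual ℝ (MvPolynomial (Fin n) ℝ)} (h : NonnegOn (localizingSet A) ⊤ F)
    (h1 : F 1 = 0) (p : MvPolynomial (Fin n) ℝ) : F p = 0 := by
  have := h.abs_le (p := p) (by simp)
  rw [h1, mul_zero] at this
  exact abs_nonpos_iff.mp this

/-- The normalized functionals that are nonnegative on the quadratic module, as functions. -/
def stateSet {n : ℕ} (A : Matrix (Fin n) (Fin n) ℝ) : Set (MvPolynomial (Fin n) ℝ → ℝ) :=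
  {φ | ∃ F : Module.Dual ℝ (MvPolynomial (Fin n) ℝ),
    NonnegOn (localizingSet A) ⊤ F ∧ F 1 = 1 ∧ ⇑F = φ}

/-- In the topology of pointwise convergence this is a closed subset of a product of the intervals
`[-polyBound A p, polyBound A p]`, so Tychonoff applies. -/
theorem isCompact_stateSet {n : ℕ} (A : Matrix (Fin n) (Fin n) ℝ) : IsCompact (stateSet A) := by
  have e : stateSet A = {φ | (∀ p q, φ (p + q) = φ p + φ q) ∧ (∀ (c : ℝ) p, φ (c • p) = c * φ p) ∧
      (∀ g ∈ localizingSet A ∪ {1}, ∀ p, 0 ≤ φ (g * p ^ 2)) ∧ φ 1 = 1} := by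
    ext φ
    constructor
    · rintro ⟨F, h1, h2, rfl⟩
      exact ⟨map_add F, fun c p => by simp, fun g hg p => h1 g hg p (by simp), h2⟩
    · rintro ⟨h1, h2, h3, h4⟩
      exact ⟨{ toFun := φ, map_add' := h1, map_smul' := h2 }, fun g hg p _ => h3 g hg p, h4, rfl⟩
  refine (isCompact_univ_pi (s := fun p => Set.Icc (-polyBound A p) (polyBound A p))
    fun p => isCompact_Icc).of_isClosed_subset ?_ ?_
  · rw [e]
    simp only [Set.ofPred_and, Set.ofPred_forall]
    refine IsClosed.inter ?_ (IsClosed.inter ?_ (IsClosed.inter ?_ ?_))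
    · exact isClosed_iInter fun p => isClosed_iInter fun q =>
        isClosed_eq (by fun_prop) (by fun_prop)
    · exact isClosed_iInter fun p => isClosed_iInter fun q =>
        isClosed_eq (by fun_prop) (by fun_prop)
    · exact isClosed_iInter fun g => isClosed_iInter fun _ => isClosed_iInter fun p =>
        isClosed_le (by fun_prop) (by fun_prop)
    · exact isClosed_eq (by fun_prop) (by fun_prop)
  · rintro _ ⟨F, h1, h2, rfl⟩ p _
    have := h1.abs_le (p := p) (by simp)
    rw [h2, mul_one] at this
    exact abs_le.mp this

/-- With `G = F(q² ·)`, both `G` and `N F - G` are nonnegative on the quadratic module, and `F` is a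
convex combination of their normalizations. Extremality makes `G` proportional to `F`. The strict
inequality `F (q²) < N` lets the second one be normalized; if `F (q²) = 0`, then `G` has mass zero
and vanishes. -/
theorem sq_mul_of_extreme {n : ℕ} {A : Matrix (Fin n) (Fin n) ℝ}
    {F : Module.Dual ℝ (MvPolynomial (Fin n) ℝ)}
    (hF : ⇑F ∈ (stateSet A).extremePoints ℝ) (h : NonnegOn (localizingSet A) ⊤ F) (h1 : F 1 = 1)
    {q : MvPolynomial (Fin n) ℝ} {N : ℝ} (hN : 0 < N) (hlt : F (q ^ 2) < N)
    (hq : ∀ p, F ((q * p) ^ 2) ≤ N * F (p ^ 2)) (f : MvPolynomial (Fin n) ℝ) :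
    F (q ^ 2 * f) = F (q ^ 2) * F f := by
  let G : Module.Dual ℝ (MvPolynomial (Fin n) ℝ) := F ∘ₗ LinearMap.mulLeft ℝ (q ^ 2)
  have hG : ∀ f, G f = F (q ^ 2 * f) := fun f => rfl
  have hG0 : NonnegOn (localizingSet A) ⊤ G := fun g hg p _ => by
    rw [hG, show q ^ 2 * (g * p ^ 2) = g * (q * p) ^ 2 by ring]
    exact h g hg _ (by simp)
  rcases (h.sq q (by simp)).lt_or_eq with hpos | hz
  · have hd : 0 < N - F (q ^ 2) := sub_pos.mpr hlt
    have m1 : ⇑((F (q ^ 2))⁻¹ • G) ∈ stateSet A := by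
      refine ⟨_, fun g hg p hp => ?_, ?_, rfl⟩
      · exact mul_nonneg (inv_nonneg.mpr hpos.le) (hG0 g hg p hp)
      · simp only [LinearMap.smul_apply, hG, mul_one, smul_eq_mul]
        exact inv_mul_cancel₀ hpos.ne'
    have m2 : ⇑((N - F (q ^ 2))⁻¹ • (N • F - G)) ∈ stateSet A := by
      refine ⟨_, fun g hg p hp => ?_, ?_, rfl⟩
      · refine mul_nonneg (inv_nonneg.mpr hd.le) ?_
        exact sub_nonneg.mpr (h.sq_mul_le hN hq hg p)
      · simp only [LinearMap.smul_apply, LinearMap.sub_apply, hG, mul_one, smul_eq_mul, h1]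
        exact inv_mul_cancel₀ hd.ne'
    have := (mem_extremePoints.mp hF).2 _ m1 _ m2 ⟨F (q ^ 2) / N, (N - F (q ^ 2)) / N,
      div_pos hpos hN, div_pos hd hN, by rw [← add_div]; field_simp; ring, by
        funext f
        simp only [Pi.add_apply, Pi.smul_apply, LinearMap.smul_apply, LinearMap.sub_apply,
          smul_eq_mul]
        field_simp
        ring⟩
    have h2 := congrFun this.1 f
    simp only [LinearMap.smul_apply, smul_eq_mul, hG] at h2
    rw [← h2, mul_inv_cancel_left₀ hpos.ne']
  · rw [← hz, zero_mul, ← hG]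
    exact hG0.eq_zero_of_one (by rw [hG, mul_one, ← hz]) f

/-- By the parallelogram identity `2 + 2 √(A i i) ^ 2` would already do. The `3` secures the strict
inequality needed in `sq_mul_of_extreme`. -/
theorem NonnegOn.one_add_X_sq_le {n : ℕ} {A : Matrix (Fin n) (Fin n) ℝ}
    {F : Module.Dual ℝ (MvPolynomial (Fin n) ℝ)} (h : NonnegOn (localizingSet A) ⊤ F)
    (i : Fin n) (p : MvPolynomial (Fin n) ℝ) :
    F (((1 + X i) * p) ^ 2) ≤ (3 + 2 * √(A i i) ^ 2) * F (p ^ 2) ∧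
    F (((1 - X i) * p) ^ 2) ≤ (3 + 2 * √(A i i) ^ 2) * F (p ^ 2) := by
  have h0 := h.sq p (by simp)
  have h1 := h.sq ((1 + X i) * p) (by simp)
  have h2 := h.sq ((1 - X i) * p) (by simp)
  have h3 := h.X_sq_mul_sq_le i p (by simp)
  have e := congrArg F (show ((1 + X i) * p) ^ 2 + ((1 - X i) * p) ^ 2 =
    (2 : ℝ) • p ^ 2 + (2 : ℝ) • (X i * p) ^ 2 by
      simp only [smul_eq_C_mul, map_ofNat]; ring)
  simp only [map_add, map_smul, smul_eq_mul] at e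
  constructor <;> linarith

theorem exists_eval_of_extreme {n : ℕ} {A : Matrix (Fin n) (Fin n) ℝ}
    {φ : MvPolynomial (Fin n) ℝ → ℝ} (hφ : φ ∈ (stateSet A).extremePoints ℝ) :
    ∃ a ∈ positivityDomain (localizingSet A), ∀ p, φ p = eval a p := by
  obtain ⟨F, h, h1, rfl⟩ := hφ.1
  have hX : ∀ i f, F (X i * f) = F (X i) * F f := by
    intro i f
    have hN : 0 < 3 + 2 * √(A i i) ^ 2 := by positivity
    have hX2 := h.X_sq_mul_sq_le i 1 (by simp)
    have e0 := congrArg F (show (1 + X i : MvPolynomial (Fin n) ℝ) ^ 2 + (1 - X i) ^ 2 =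
      (2 : ℝ) • 1 + (2 : ℝ) • (X i * 1) ^ 2 by
        simp only [smul_eq_C_mul, map_ofNat]; ring)
    have n1 := h.sq (1 + X i) (by simp)
    have n2 := h.sq (1 - X i) (by simp)
    simp only [map_add, map_smul, smul_eq_mul, one_pow, h1] at e0 hX2
    -- Multiplicativity is known for squares only; it passes to `X i` through `4 X i = (1 + X i)² -
    -- (1 - X i)²`.
    have m1 := sq_mul_of_extreme hφ h h1 hN (q := 1 + X i) (by linarith)
      (fun p => (h.one_add_X_sq_le i p).1) f
    have m2 := sq_mul_of_extreme hφ h h1 hN (q := 1 - X i) (by linarith)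
      (fun p => (h.one_add_X_sq_le i p).2) f
    have e1 := congrArg F (show (1 + X i) ^ 2 * f - (1 - X i) ^ 2 * f = (4 : ℝ) • (X i * f) by
      simp only [smul_eq_C_mul, map_ofNat]; ring)
    have e2 := congrArg F (show (1 + X i : MvPolynomial (Fin n) ℝ) ^ 2 - (1 - X i) ^ 2 =
      (4 : ℝ) • X i by simp only [smul_eq_C_mul, map_ofNat]; ring)
    simp only [map_sub, map_smul, smul_eq_mul] at e1 e2
    linear_combination (1 / 4) * (m1 - m2 - e1) + (1 / 4) * F f * e2
  have hev : ∀ p, F p = eval (fun i => F (X i)) p := by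
    intro p
    induction p using MvPolynomial.induction_on with
    | C c => rw [← mul_one (C c), ← smul_eq_C_mul, map_smul, h1]; simp
    | add p q hp hq => rw [map_add, map_add, hp, hq]
    | mul_X p i hp => rw [mul_comm, hX, hp, map_mul, eval_X]
  refine ⟨_, fun g hg => ?_, hev⟩
  rw [← hev]
  simpa using h g (Or.inl hg) 1 (by simp)

/-- The functional form of Putinar's Positivstellensatz for `localizingSet A`. -/
theorem NonnegOn.nonneg_of_nonneg_on_domain {n : ℕ} {A : Matrix (Fin n) (Fin n) ℝ}
    {F : Module.Dual ℝ (MvPolynomial (Fin n) ℝ)} (h : NonnegOn (localizingSet A) ⊤ F)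
    {f : MvPolynomial (Fin n) ℝ}
    (hf : ∀ a ∈ positivityDomain (localizingSet A), 0 ≤ eval a f) : 0 ≤ F f := by
  rcases h.one_nonneg.lt_or_eq with hpos | hz
  swap
  · rw [h.eq_zero_of_one hz.symm]
  have hmem : ⇑((F 1)⁻¹ • F) ∈ stateSet A :=
    ⟨_, fun g hg p hp => mul_nonneg (inv_nonneg.mpr hpos.le) (h g hg p hp),
      by simp [hpos.ne'], rfl⟩
  -- Exposed faces are sets of maximizers, hence the sign: `l` exposes the states minimizing `φ f`.
  -- An extreme point of this compact face is extreme in the whole set, so it is an evaluation at a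
  -- point of the domain.
  let l : (MvPolynomial (Fin n) ℝ → ℝ) →L[ℝ] ℝ :=
    -(ContinuousLinearMap.proj (R := ℝ) (φ := fun _ : MvPolynomial (Fin n) ℝ => ℝ) f)
  have hl : ∀ φ, l φ = -φ f := fun φ => rfl
  have hexp := ContinuousLinearMap.toExposed.isExposed (l := l) (A := stateSet A)
  obtain ⟨φ₀, hφ₀, hmax⟩ := (isCompact_stateSet A).exists_isMaxOn ⟨_, hmem⟩
    l.continuous.continuousOn
  obtain ⟨φ, hφ⟩ := (hexp.isCompact (isCompact_stateSet A)).extremePoints_nonempty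
    ⟨φ₀, hφ₀, fun y hy => hmax hy⟩
  obtain ⟨a, ha, hev⟩ := exists_eval_of_extreme (hexp.isExtreme.extremePoints_subset_extremePoints hφ)
  have h2 := hφ.1.2 _ hmem
  rw [hl, hl, hev] at h2
  simp only [LinearMap.smul_apply, smul_eq_mul] at h2
  have h3 : 0 ≤ (F 1)⁻¹ * F f := by linarith [hf a ha]
  exact nonneg_of_mul_nonneg_right h3 (inv_pos.mpr hpos)

/-! ### From functionals to conic combinations of evaluations -/

theorem convexHull_eq_biUnion_image {E : Type*} [AddCommGroup E] [Module ℝ E]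
    [FiniteDimensional ℝ E] (s : Set E) :
    convexHull ℝ s = ⋃ r ∈ Set.Iic (Module.finrank ℝ E + 1),
      (fun x : (Fin r → ℝ) × (Fin r → E) => ∑ k, x.1 k • x.2 k) ''
        (stdSimplex ℝ (Fin r) ×ˢ Set.univ.pi fun _ => s) := by
  apply Set.Subset.antisymm
  · intro x hx
    obtain ⟨ι, _, z, w, hz, hind, hw, hw1, rfl⟩ := eq_pos_convex_span_of_mem_convexHull hx
    refine Set.mem_biUnion (x := Fintype.card ι) ?_ ?_
    · exact hind.card_le_finrank_succ.trans (Nat.succ_le_succ (Submodule.finrank_le _))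
    · let e := (Fintype.equivFin ι).symm
      refine ⟨(w ∘ e, z ∘ e), ⟨⟨fun k => (hw _).le, ?_⟩, fun k _ => hz ⟨_, rfl⟩⟩, ?_⟩
      · rw [← hw1]
        exact e.sum_comp w
      · exact e.sum_comp fun i => w i • z i
  · refine Set.iUnion₂_subset fun r _ => ?_
    rintro _ ⟨⟨w, z⟩, ⟨hw, hz⟩, rfl⟩
    exact (convex_convexHull ℝ s).sum_mem (fun k _ => hw.1 k) hw.2
      fun k _ => subset_convexHull ℝ s (hz k trivial)

/-- Carathéodory's theorem bounds the number of points needed, so the hull is a finite union of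
continuous images of compact sets. -/
theorem isCompact_convexHull_of_isCompact {E : Type*} [AddCommGroup E] [Module ℝ E]
    [FiniteDimensional ℝ E] [TopologicalSpace E] [ContinuousAdd E] [ContinuousSMul ℝ E]
    {s : Set E} (hs : IsCompact s) : IsCompact (convexHull ℝ s) := by
  rw [convexHull_eq_biUnion_image]
  refine (Set.finite_Iic _).isCompact_biUnion fun r _ => ?_
  exact ((isCompact_stdSimplex ℝ (Fin r)).prod (isCompact_univ_pi fun _ => hs)).image
    (by fun_prop)

theorem exists_fin_of_mem_convexHull {E : Type*} [AddCommGroup E] [Module ℝ E]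
    [FiniteDimensional ℝ E] {s : Set E} {x : E} (hx : x ∈ convexHull ℝ s) :
    ∃ (r : ℕ) (w : Fin r → ℝ) (z : Fin r → E), (∀ k, 0 ≤ w k) ∧ ∑ k, w k = 1 ∧
      (∀ k, z k ∈ s) ∧ ∑ k, w k • z k = x := by
  rw [convexHull_eq_biUnion_image] at hx
  obtain ⟨r, _, ⟨w, z⟩, ⟨hw, hz⟩, h⟩ := Set.mem_iUnion₂.mp hx
  exact ⟨r, w, z, hw.1, hw.2, fun k => hz k trivial, h⟩

theorem isCompact_positivityDomain {n : ℕ} (A : Matrix (Fin n) (Fin n) ℝ) :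
    IsCompact (positivityDomain (localizingSet A)) := by
  refine (isCompact_univ_pi (s := fun i => Set.Icc 0 √(A i i))
    fun i => isCompact_Icc).of_isClosed_subset ?_ ?_
  · have : positivityDomain (localizingSet A) =
        ⋂ g ∈ localizingSet A, {a | 0 ≤ eval a g} := by
      ext a
      simp [positivityDomain]
    rw [this]
    exact isClosed_biInter fun g _ => isClosed_le continuous_const (continuous_eval g)
  · intro a ha i _
    have h := ha _ (Or.inl ⟨i, rfl⟩)
    simp only [map_sub, map_mul, eval_C, eval_X, map_pow] at h
    have := Real.sqrt_nonneg (A i i)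
    constructor <;> nlinarith

theorem mass_mem_conicValues {n : ℕ} {A : Matrix (Fin n) (Fin n) ℝ}
    {F : Module.Dual ℝ (MvPolynomial (Fin n) ℝ)} (h : NonnegOn (localizingSet A) ⊤ F)
    (hm : ∀ i j, F (X i * X j) = A i j) : F 1 ∈ conicValues A := by
  rcases h.one_nonneg.lt_or_eq with hpos | hz
  swap
  · exact ⟨F, ⟨0, 0, 0, by simp, fun k => k.elim0, fun p => by
      simp [h.eq_zero_of_one hz.symm]⟩, hm, rfl⟩
  let φ : (Fin n → ℝ) → (Fin n × Fin n → ℝ) := fun a ij => a ij.1 * a ij.2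
  have hφ : Continuous φ := by fun_prop
  have hcomp : IsCompact (convexHull ℝ (φ '' positivityDomain (localizingSet A))) :=
    isCompact_convexHull_of_isCompact ((isCompact_positivityDomain A).image hφ)
  have hv : (fun ij : Fin n × Fin n => A ij.1 ij.2 / F 1) ∈
      convexHull ℝ (φ '' positivityDomain (localizingSet A)) := by
    by_contra hv
    obtain ⟨f, u, hfu, hub⟩ := geometric_hahn_banach_point_closed (convex_convexHull ℝ _)
      hcomp.isClosed hv
    have hf : ∀ b, f b = ∑ ij, b ij * f (Pi.single ij 1) := by
      intro b
      conv_lhs => rw [pi_eq_sum_univ' b]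
      simp [map_sum]
    -- The separating hyperplane, read as a quadratic polynomial: it is positive on the domain,
    -- while `F P` would be negative.
    let P : MvPolynomial (Fin n) ℝ :=
      ∑ ij : Fin n × Fin n, f (Pi.single ij 1) • (X ij.1 * X ij.2) - u • 1
    have hP : 0 ≤ F P := h.nonneg_of_nonneg_on_domain fun a ha => by
      have h1 := hub _ (subset_convexHull ℝ _ ⟨a, ha, rfl⟩)
      rw [hf] at h1
      have h2 : eval a P = ∑ ij, φ a ij * f (Pi.single ij 1) - u := by
        simp only [P, map_sub, map_sum, smul_eval, map_mul, eval_X, map_one, mul_one, φ]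
        simp only [mul_comm]
      rw [h2]
      exact (sub_pos.mpr h1).le
    have hFP : F P = F 1 * (f (fun ij => A ij.1 ij.2 / F 1) - u) := by
      rw [hf]
      simp only [P, map_sub, map_sum, map_smul, smul_eq_mul, hm, mul_sub, Finset.mul_sum]
      congr 1
      · refine Finset.sum_congr rfl fun ij _ => ?_
        field_simp
      · ring
    rw [hFP] at hP
    have := nonneg_of_mul_nonneg_right hP hpos
    linarith
  obtain ⟨r, w, z, hw, hw1, hz, hsum⟩ := exists_fin_of_mem_convexHull hv
  choose a ha haz using hz
  let L : Module.Dual ℝ (MvPolynomial (Fin n) ℝ) := ∑ k, (F 1 * w k) • (aeval (a k)).toLinearMap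
  have hL : ∀ p, L p = ∑ k, F 1 * w k * eval (a k) p := fun p => by
    simp only [L, LinearMap.sum_apply, LinearMap.smul_apply, AlgHom.toLinearMap_apply, smul_eq_mul]
    rfl
  refine ⟨L, ⟨r, _, a, fun k => mul_nonneg hpos.le (hw k), ha, hL⟩, fun i j => ?_, ?_⟩
  · have h1 := congrFun hsum (i, j)
    simp only [Finset.sum_apply, Pi.smul_apply, ← haz, φ, smul_eq_mul] at h1
    rw [hL]
    simp only [map_mul, eval_X, mul_assoc]
    rw [← Finset.mul_sum, h1]
    field_simp
  · rw [hL]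
    simp [← Finset.mul_sum, hw1]

theorem conicValues_subset_valuesStar {n : ℕ} (A : Matrix (Fin n) (Fin n) ℝ) :
    conicValues A ⊆ valuesStar A := by
  rintro _ ⟨F, ⟨r, c, a, hc, ha, hF⟩, hm, rfl⟩
  refine ⟨_, isFeasible_domRestrict (t := ⊤) (F := F) (fun g hg p _ => ?_) hm, ?_, rfl⟩
  · rw [hF]
    refine Finset.sum_nonneg fun k _ => mul_nonneg (hc k) ?_
    rw [map_mul, map_pow]
    refine mul_nonneg ?_ (sq_nonneg _)
    rcases hg with hg | rfl
    · exact ha k g hg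
    · simp
  -- Every column of the moment matrix is a combination of the `r` vectors of monomial values at the
  -- points `a k`.
  · rw [Matrix.eRank, Cardinal.toENat_lt_top, Matrix.cRank]
    let ζ : Fin r → Mon n ⊤ → ℝ := fun k w => eval (a k) (monomial w.1 1)
    have : FiniteDimensional ℝ (Submodule.span ℝ (Set.range ζ)) :=
      FiniteDimensional.span_of_finite ℝ (Set.finite_range ζ)
    refine lt_of_le_of_lt (Submodule.rank_mono (t := Submodule.span ℝ (Set.range ζ)) ?_)
      (Module.rank_lt_aleph0 ℝ _)
    rw [Submodule.span_le]
    rintro _ ⟨u, rfl⟩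
    have : (momentMatrix (t := ⊤) (F.domRestrict (polyLE n (2 * ⊤)))).col u =
        ∑ k, (c k * ζ k u) • ζ k := by
      funext w
      simp only [Finset.sum_apply, Pi.smul_apply, smul_eq_mul, ζ]
      change F (monomial (w.1 + u.1) 1) = _
      rw [hF]
      refine Finset.sum_congr rfl fun k _ => ?_
      have e : monomial (w.1 + u.1) (1 : ℝ) = monomial w.1 1 * monomial u.1 1 := by
        rw [monomial_mul, one_mul]
      rw [e, map_mul]
      ring
    rw [this]
    exact Submodule.sum_mem _ fun k _ =>
      Submodule.smul_mem _ _ (Submodule.subset_span ⟨k, rfl⟩)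

theorem valuesStar_subset_values {n : ℕ} (A : Matrix (Fin n) (Fin n) ℝ) :
    valuesStar A ⊆ values A ⊤ := fun _ ⟨L, hL, _, hr⟩ => ⟨L, hL, hr⟩

theorem values_subset_conicValues {n : ℕ} (A : Matrix (Fin n) (Fin n) ℝ) :
    values A ⊤ ⊆ conicValues A := by
  intro r hr
  obtain ⟨F, h1, h2, rfl⟩ := (mem_values_iff le_top).mp hr
  exact mass_mem_conicValues h1 h2

theorem values_top_eq_conicValues {n : ℕ} (A : Matrix (Fin n) (Fin n) ℝ) :
    values A ⊤ = conicValues A :=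
  (values_subset_conicValues A).antisymm
    ((conicValues_subset_valuesStar A).trans (valuesStar_subset_values A))

theorem values_top_eq_valuesStar {n : ℕ} (A : Matrix (Fin n) (Fin n) ℝ) :
    values A ⊤ = valuesStar A :=
  ((values_subset_conicValues A).trans (conicValues_subset_valuesStar A)).antisymm
    (valuesStar_subset_values A)

/-- The columns of the factor `B`, each with weight `1`, serve as points. They lie in the domain
because each term of `∑ k, B i k * B j k` is at most the sum, all terms being nonnegative. -/
theorem IsCompletelyPositive.conicValues_nonempty {n : ℕ} {A : Matrix (Fin n) (Fin n) ℝ}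
    (hA : IsCompletelyPositive A) : (conicValues A).Nonempty := by
  obtain ⟨d, B, hB, rfl⟩ := hA
  have hAij : ∀ i j, (B * B.transpose) i j = ∑ k, B i k * B j k := fun i j => rfl
  have hle : ∀ i j k, B i k * B j k ≤ (B * B.transpose) i j := fun i j k => by
    rw [hAij]
    exact Finset.single_le_sum (f := fun k => B i k * B j k)
      (fun k _ => mul_nonneg (hB i k) (hB j k)) (Finset.mem_univ k)
  let L : Module.Dual ℝ (MvPolynomial (Fin n) ℝ) :=
    ∑ k, (aeval fun i => B i k).toLinearMap
  have hL : ∀ p, L p = ∑ k, eval (fun i => B i k) p := fun p => by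
    simp only [L, LinearMap.sum_apply, AlgHom.toLinearMap_apply]
    rfl
  refine ⟨L 1, L, ⟨d, 1, fun k i => B i k, by simp, ?_, fun p => by simp [hL]⟩,
    fun i j => by simp [hL, hAij], rfl⟩
  rintro k g (⟨i, rfl⟩ | ⟨i, j, _, rfl⟩)
  · simp only [map_sub, map_mul, eval_C, eval_X, map_pow]
    have h1 : B i k ≤ √((B * B.transpose) i i) :=
      Real.le_sqrt_of_sq_le (by rw [sq]; exact hle i i k)
    nlinarith [hB i k]
  · simp only [map_sub, map_mul, eval_C, eval_X]
    exact sub_nonneg.mpr (hle i j k)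

/-! ### Flat extension -/

theorem polyLE_mono {n : ℕ} {d e : ℕ∞} (h : d ≤ e) : polyLE n d ≤ polyLE n e :=
  fun _ hp => le_trans (mem_polyLE.mp hp) h

theorem mul_mem_polyLE {n : ℕ} {d e : ℕ∞} {p q : MvPolynomial (Fin n) ℝ} (hp : p ∈ polyLE n d)
    (hq : q ∈ polyLE n e) : p * q ∈ polyLE n (d + e) := by
  rw [mem_polyLE] at *
  calc ((p * q).totalDegree : ℕ∞) ≤ (p.totalDegree : ℕ∞) + q.totalDegree := by
        exact_mod_cast totalDegree_mul p q
    _ ≤ d + e := add_le_add hp hq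

theorem monomial_mem_polyLE_of_degree_le {n : ℕ} {d : ℕ∞} {w : Fin n →₀ ℕ}
    (hw : (w.degree : ℕ∞) ≤ d) : monomial w (1 : ℝ) ∈ polyLE n d :=
  le_trans (by exact_mod_cast totalDegree_monomial_le w (1 : ℝ)) hw

theorem polyLE_le_span {n : ℕ} (d : ℕ∞) :
    polyLE n d ≤ Submodule.span ℝ (Set.range fun u : Mon n d => monomial u.1 (1 : ℝ)) := by
  intro p hp
  rw [p.as_sum]
  refine Submodule.sum_mem _ fun w hw => ?_
  rw [show monomial w (coeff w p) = coeff w p • monomial w (1 : ℝ) by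
    rw [smul_monomial, smul_eq_mul, mul_one]]
  refine Submodule.smul_mem _ _ (Submodule.subset_span ⟨⟨w, le_trans ?_ (mem_polyLE.mp hp)⟩, rfl⟩)
  have := le_totalDegree hw
  rw [Finsupp.sum_fintype _ _ (by simp)] at this
  rw [Finsupp.degree_eq_sum]
  exact_mod_cast this

theorem finite_mon {n : ℕ} (m : ℕ) : Finite (Mon n (m : ℕ∞)) := by
  have := (Finsupp.finite_of_degree_le (σ := Fin n) m).to_subtype
  refine Finite.of_injective (β := {w : Fin n →₀ ℕ | w.degree ≤ m})
    (fun w => ⟨w.1, Nat.cast_le.mp w.2⟩) fun u v h => Subtype.ext (congrArg (fun x => x.1) h)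

/-- Flatness, in terms of polynomials: modulo the kernel of the moment form, every polynomial of
degree at most `m + 1` reduces to one of degree at most `m`. -/
theorem IsFlat.exists_reduction {n m : ℕ} {F : Module.Dual ℝ (MvPolynomial (Fin n) ℝ)}
    (h : IsFlat (t := ((m + 1 : ℕ) : ℕ∞)) (F.domRestrict (polyLE n (2 * ((m + 1 : ℕ) : ℕ∞)))))
    {p : MvPolynomial (Fin n) ℝ} (hp : p ∈ polyLE n ((m + 1 : ℕ) : ℕ∞)) :
    ∃ p' ∈ polyLE n (m : ℕ∞), ∀ q ∈ polyLE n ((m + 1 : ℕ) : ℕ∞), F ((p - p') * q) = 0 := by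
  rcases h with ⟨-, δ, hδ, hδt, hrank⟩ | ⟨h, -⟩
  swap
  · exact absurd h (ENat.natCast_ne_top _)
  have hs : ((m + 1 : ℕ) : ℕ∞) - δ ≤ m := by
    refine tsub_le_iff_right.mpr ?_
    push_cast
    gcongr
  set s : ℕ∞ := ((m + 1 : ℕ) : ℕ∞) - δ
  set M := momentMatrix (t := ((m + 1 : ℕ) : ℕ∞)) (F.domRestrict (polyLE n _))
  have : Finite (Mon n ((m + 1 : ℕ) : ℕ∞)) := finite_mon (m + 1)
  let M' := M.submatrix id (Subtype.val : {u : Mon n ((m + 1 : ℕ) : ℕ∞) // (u.1.degree : ℕ∞) ≤ s} → _)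
  have hfin : ∀ {κ : Type} (K : Matrix (Mon n ((m + 1 : ℕ) : ℕ∞)) κ ℝ), K.eRank ≠ ⊤ := by
    intro κ K
    refine ne_top_of_le_ne_top ?_ K.eRank_le_card_height
    rwa [ne_eq, ENat.card_eq_top, not_infinite_iff_finite]
  -- `M'` keeps all rows but only the columns of degree at most `s`. Its rank lies between those of
  -- the principal submatrix and of `M`, so flatness makes the column spaces of `M'` and `M` equal.
  have hle : M.eRank ≤ M'.eRank := by
    rw [hrank]
    exact M'.eRank_submatrix_le Subtype.val id
  have hspan : Submodule.span ℝ (Set.range M'.col) = Submodule.span ℝ (Set.range M.col) := by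
    refine Submodule.eq_of_le_of_finrank_le (Submodule.span_mono ?_) ?_
    · rintro _ ⟨u, rfl⟩
      exact ⟨u.1, rfl⟩
    · rw [← Matrix.eRank_toNat_eq_finrank, ← Matrix.eRank_toNat_eq_finrank]
      exact ENat.toNat_le_toNat hle (hfin _)
  let T : MvPolynomial (Fin n) ℝ →ₗ[ℝ] (Mon n ((m + 1 : ℕ) : ℕ∞) → ℝ) :=
    LinearMap.pi fun w => F ∘ₗ LinearMap.mulLeft ℝ (monomial w.1 1)
  have hT : ∀ p w, T p w = F (monomial w.1 1 * p) := fun _ _ => rfl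
  have hcol : ∀ u : Mon n ((m + 1 : ℕ) : ℕ∞), M.col u = T (monomial u.1 1) := by
    intro u
    funext w
    rw [hT, monomial_mul, one_mul]
    rfl
  have hsub : Submodule.span ℝ (Set.range M.col) ≤ (polyLE n (m : ℕ∞)).map T := by
    rw [← hspan, Submodule.span_le]
    rintro _ ⟨u, rfl⟩
    exact ⟨monomial u.1.1 1, monomial_mem_polyLE_of_degree_le (u.2.trans hs), (hcol u.1).symm⟩
  have hmem : T p ∈ (polyLE n (m : ℕ∞)).map T := by
    refine (Submodule.span_le (p := ((polyLE n (m : ℕ∞)).map T).comap T)).mpr ?_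
      (polyLE_le_span _ hp)
    rintro _ ⟨u, rfl⟩
    exact hsub (Submodule.subset_span ⟨u, hcol u⟩)
  obtain ⟨p', hp', he⟩ := hmem
  refine ⟨p', hp', fun q hq => ?_⟩
  refine (Submodule.span_le (p := LinearMap.ker (F ∘ₗ LinearMap.mulLeft ℝ (p - p')))).mpr ?_
    (polyLE_le_span _ hq)
  rintro _ ⟨u, rfl⟩
  have := congrFun he u
  rw [hT, hT] at this
  change F ((p - p') * monomial u.1 1) = 0
  rw [mul_comm, mul_sub, map_sub, this, sub_self]

open scoped IsMulCommutative in
theorem exists_aeval_of_commute {σ E : Type*} [Ring E] [Algebra ℝ E] (T : σ → E)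
    (hT : ∀ i j, T i * T j = T j * T i) :
    ∃ ψ : MvPolynomial σ ℝ →ₐ[ℝ] E, ∀ i, ψ (X i) = T i := by
  have := Algebra.isMulCommutative_adjoin ℝ (s := Set.range T) (by
    rintro _ ⟨i, rfl⟩ _ ⟨j, rfl⟩
    exact hT i j)
  refine ⟨(Algebra.adjoin ℝ (Set.range T)).val.comp
    (aeval fun i => (⟨T i, Algebra.subset_adjoin ⟨i, rfl⟩⟩ : Algebra.adjoin ℝ (Set.range T))), fun i => ?_⟩
  simp

theorem exists_factor_of_surjective {W V V' : Type*} [AddCommGroup W] [AddCommGroup V]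
    [AddCommGroup V'] [Module ℝ W] [Module ℝ V] [Module ℝ V'] {f : W →ₗ[ℝ] V}
    (hf : Function.Surjective f) (g : W →ₗ[ℝ] V') (h : ∀ w, f w = 0 → g w = 0) :
    ∃ k : V →ₗ[ℝ] V', ∀ w, k (f w) = g w := by
  obtain ⟨s, hs⟩ := f.exists_rightInverse_of_surjective (LinearMap.range_eq_top.mpr hf)
  refine ⟨g ∘ₗ s, fun w => ?_⟩
  rw [← sub_eq_zero, LinearMap.comp_apply, ← map_sub]
  apply h
  rw [map_sub, sub_eq_zero]
  exact LinearMap.congr_fun hs (f w)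

/-- The polynomials of degree at most `m + 1` are generated from `1` by linear combinations and by
multiplying polynomials of degree at most `m` by variables. -/
theorem polyLE_induction {n m : ℕ} {P : MvPolynomial (Fin n) ℝ → Prop} (one : P 1)
    (X_mul : ∀ i, ∀ v ∈ polyLE n (m : ℕ∞), P v → P (X i * v))
    (add : ∀ p q, P p → P q → P (p + q)) (smul : ∀ (c : ℝ) p, P p → P (c • p))
    {p : MvPolynomial (Fin n) ℝ} (hp : p ∈ polyLE n ((m + 1 : ℕ) : ℕ∞)) : P p := by
  have hmon : ∀ (d : ℕ) (w : Fin n →₀ ℕ), w.degree = d → d ≤ m + 1 → P (monomial w 1) := by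
    intro d
    induction d with
    | zero =>
      intro w hw _
      rw [(Finsupp.degree_eq_zero_iff w).mp hw]
      exact one
    | succ d ih =>
      intro w hd hw
      obtain ⟨i, v, rfl⟩ := exists_single_add (w := w) (by omega)
      rw [map_add, Finsupp.degree_single] at hd
      rw [show monomial (Finsupp.single i 1 + v) (1 : ℝ) = X i * monomial v 1 by
        rw [X, monomial_mul, one_mul]]
      exact X_mul i _ (monomial_mem_polyLE_of_degree_le
        (by exact_mod_cast (by omega : v.degree ≤ m))) (ih v (by omega) (by omega))
  refine Submodule.span_induction (p := fun p _ => P p) ?_ ?_ (fun p q _ _ => add p q)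
    (fun c p _ => smul c p) (polyLE_le_span _ hp)
  · rintro _ ⟨u, rfl⟩
    exact hmon _ u.1 rfl (by exact_mod_cast u.2)
  · simpa using smul 0 1 one

/-- A GNS-type construction without positivity. Let `N` be the kernel of the form `F (p q)` on
degree at most `m + 1`. Each class modulo `N` has a representative of degree at most `m`, which can
be multiplied by `X i` within the space. The resulting operators commute, so polynomials act on the
quotient, and `G p` is the value of `F` on `p` applied to the class of `1`. -/
theorem exists_flat_extension {n m : ℕ} (F : Module.Dual ℝ (MvPolynomial (Fin n) ℝ))
    (hflat : ∀ p ∈ polyLE n ((m + 1 : ℕ) : ℕ∞), ∃ p' ∈ polyLE n (m : ℕ∞),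
      ∀ q ∈ polyLE n ((m + 1 : ℕ) : ℕ∞), F ((p - p') * q) = 0) :
    ∃ G : Module.Dual ℝ (MvPolynomial (Fin n) ℝ),
      (∀ p ∈ polyLE n (2 * ((m + 1 : ℕ) : ℕ∞)), G p = F p) ∧
      ∀ p, ∃ p' ∈ polyLE n (m : ℕ∞), ∀ q, G (q * (p - p')) = 0 := by
  let N : Submodule ℝ (polyLE n ((m + 1 : ℕ) : ℕ∞)) :=
    { carrier := {p | ∀ q ∈ polyLE n ((m + 1 : ℕ) : ℕ∞), F (p * q) = 0}
      zero_mem' := fun q _ => by simp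
      add_mem' := fun {a b} ha hb q hq => by
        simp [add_mul, ha q hq, hb q hq]
      smul_mem' := fun c a ha q hq => by
        simp [ha q hq] }
  have hN : ∀ p, N.mkQ p = 0 ↔ ∀ q ∈ polyLE n ((m + 1 : ℕ) : ℕ∞), F (p * q) = 0 := fun p => by
    rw [Submodule.mkQ_apply, Submodule.Quotient.mk_eq_zero]
    rfl
  have hWU : polyLE n (m : ℕ∞) ≤ polyLE n ((m + 1 : ℕ) : ℕ∞) :=
    polyLE_mono (by exact_mod_cast Nat.le_succ m)
  have hXU : ∀ i, ∀ p ∈ polyLE n (m : ℕ∞), X i * p ∈ polyLE n ((m + 1 : ℕ) : ℕ∞) := by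
    intro i p hp
    have hXi : (X i : MvPolynomial (Fin n) ℝ) ∈ polyLE n 1 := by
      rw [mem_polyLE, totalDegree_X]
      simp
    have := mul_mem_polyLE hXi hp
    rwa [add_comm] at this
  let f : polyLE n (m : ℕ∞) →ₗ[ℝ] _ := N.mkQ ∘ₗ Submodule.inclusion hWU
  have hf : ∀ p (hp : p ∈ polyLE n (m : ℕ∞)), f ⟨p, hp⟩ = N.mkQ ⟨p, hWU hp⟩ := fun _ _ => rfl
  have hred : ∀ p hp, ∃ p', ∃ hp' : p' ∈ polyLE n (m : ℕ∞), f ⟨p', hp'⟩ = N.mkQ ⟨p, hp⟩ ∧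
      ∀ q ∈ polyLE n ((m + 1 : ℕ) : ℕ∞), F (p * q) = F (p' * q) := by
    intro p hp
    obtain ⟨p', hp', h⟩ := hflat p hp
    refine ⟨p', hp', ?_, fun q hq => ?_⟩
    · rw [hf, eq_comm, ← sub_eq_zero, ← map_sub, hN]
      exact h
    · rw [← sub_eq_zero, ← map_sub, ← sub_mul]
      exact h q hq
  have hsurj : Function.Surjective f := by
    intro v
    obtain ⟨⟨p, hp⟩, rfl⟩ := N.mkQ_surjective v
    obtain ⟨p', hp', h, _⟩ := hred p hp
    exact ⟨_, h⟩
  -- The form is symmetric and the second argument can be reduced too, so testing against degree at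
  -- most `m` suffices. This leaves room to move one variable across the form.
  have hNW : ∀ p : polyLE n ((m + 1 : ℕ) : ℕ∞),
      (∀ q ∈ polyLE n (m : ℕ∞), F (p * q) = 0) → N.mkQ p = 0 := by
    intro p h
    rw [hN]
    intro q hq
    obtain ⟨q', hq', _, h'⟩ := hred q hq
    rw [mul_comm, h' _ p.2, mul_comm]
    exact h q' hq'
  let μ : Fin n → polyLE n (m : ℕ∞) →ₗ[ℝ] polyLE n ((m + 1 : ℕ) : ℕ∞) := fun i =>
    ((LinearMap.mulLeft ℝ (X i)).domRestrict _).codRestrict _ fun p => hXU i p p.2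
  have hμ : ∀ i p, (μ i p : MvPolynomial (Fin n) ℝ) = X i * p.1 := fun _ _ => rfl
  have hT : ∀ i, ∃ T : Module.End ℝ (polyLE n ((m + 1 : ℕ) : ℕ∞) ⧸ N),
      ∀ p, T (f p) = N.mkQ (μ i p) := by
    intro i
    refine exists_factor_of_surjective hsurj (N.mkQ ∘ₗ μ i) fun p hp => ?_
    refine hNW _ fun q hq => ?_
    rw [hμ, show X i * p.1 * q = p.1 * (X i * q) by ring]
    exact (hN _).mp hp _ (hXU i q hq)
  choose T hT using hT
  -- Paired with `q` of degree at most `m`, both composites give `F (X i * X j * w * q)`.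
  have hcomm : ∀ i j, T i * T j = T j * T i := by
    intro i j
    refine LinearMap.ext fun v => ?_
    obtain ⟨w, rfl⟩ := hsurj v
    obtain ⟨wi, hwi, hi, hi'⟩ := hred _ (μ i w).2
    obtain ⟨wj, hwj, hj, hj'⟩ := hred _ (μ j w).2
    rw [Module.End.mul_apply, Module.End.mul_apply, hT, hT, ← hi, ← hj, hT, hT, ← sub_eq_zero,
      ← map_sub]
    refine hNW _ fun q hq => ?_
    have e1 := hi' _ (hXU j q hq)
    have e2 := hj' _ (hXU i q hq)
    rw [hμ] at e1 e2
    rw [Submodule.coe_sub, hμ, hμ, sub_mul, map_sub, sub_eq_zero,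
      show X i * wj * q = wj * (X i * q) by ring, show X j * wi * q = wi * (X j * q) by ring,
      ← e1, ← e2]
    congr 1
    ring
  obtain ⟨ψ, hψ⟩ := exists_aeval_of_commute T hcomm
  have h1U : (1 : MvPolynomial (Fin n) ℝ) ∈ polyLE n ((m + 1 : ℕ) : ℕ∞) := one_mem_polyLE _ _
  let ℓ : (polyLE n ((m + 1 : ℕ) : ℕ∞) ⧸ N) →ₗ[ℝ] ℝ :=
    N.liftQ (F.domRestrict _) fun p hp => by simpa using hp 1 h1U
  have hℓ : ∀ p, ℓ (N.mkQ p) = F p := fun _ => rfl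
  have hcyc : ∀ p (hp : p ∈ polyLE n ((m + 1 : ℕ) : ℕ∞)),
      ψ p (N.mkQ ⟨1, h1U⟩) = N.mkQ ⟨p, hp⟩ := by
    intro p hp
    refine Exists.elim (polyLE_induction (P := fun p => ∃ hp, ψ p (N.mkQ ⟨1, h1U⟩) = N.mkQ ⟨p, hp⟩)
      ⟨h1U, by rw [map_one, Module.End.one_apply]⟩ ?_ ?_ ?_ hp) fun _ h => h
    · rintro i v hv ⟨_, ih⟩
      refine ⟨hXU i v hv, ?_⟩
      rw [map_mul, Module.End.mul_apply, ih, ← hf _ hv, hψ, hT]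
      rfl
    · rintro p q ⟨hp, h1⟩ ⟨hq, h2⟩
      refine ⟨Submodule.add_mem _ hp hq, ?_⟩
      rw [map_add, LinearMap.add_apply, h1, h2, ← map_add]
      rfl
    · rintro c p ⟨hp, h1⟩
      refine ⟨Submodule.smul_mem _ c hp, ?_⟩
      rw [map_smul, LinearMap.smul_apply, h1, ← map_smul]
      rfl
  have hform : ∀ p ∈ polyLE n ((m + 1 : ℕ) : ℕ∞), ∀ q hq,
      ℓ (ψ p (N.mkQ ⟨q, hq⟩)) = F (p * q) := by
    intro p hp
    refine polyLE_induction (P := fun p => ∀ q hq, ℓ (ψ p (N.mkQ ⟨q, hq⟩)) = F (p * q))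
      ?_ ?_ ?_ ?_ hp
    · intro q hq
      rw [map_one, Module.End.one_apply, hℓ, one_mul]
    · intro i v hv ih q hq
      obtain ⟨q', hq', h1, h2⟩ := hred q hq
      -- The factors are swapped so that `X i` acts first, on the representative `q'` of degree at
      -- most `m`, where its action is explicit.
      rw [mul_comm (X i) v, map_mul, Module.End.mul_apply, hψ, ← h1, hT]
      refine (ih _ (μ i ⟨q', hq'⟩).2).trans ?_
      rw [hμ, mul_comm v (X i), mul_comm _ q, h2 _ (hXU i v hv)]
      congr 1
      ring
    · intro p q h1 h2 r hr
      rw [map_add, LinearMap.add_apply, map_add, h1, h2, ← map_add, add_mul]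
    · intro c p h r hr
      rw [map_smul, LinearMap.smul_apply, map_smul, h, ← map_smul, smul_mul_assoc]
  let G : Module.Dual ℝ (MvPolynomial (Fin n) ℝ) :=
    ℓ ∘ₗ (LinearMap.applyₗ (N.mkQ ⟨1, h1U⟩)) ∘ₗ ψ.toLinearMap
  have hG : ∀ p, G p = ℓ (ψ p (N.mkQ ⟨1, h1U⟩)) := fun _ => rfl
  refine ⟨G, fun p hp => ?_, fun p => ?_⟩
  · refine (Submodule.span_le (p := LinearMap.eqLocus G F)).mpr ?_ (polyLE_le_span _ hp)
    rintro _ ⟨⟨w, hw⟩, rfl⟩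
    obtain ⟨u, v, rfl, hu, hv⟩ := exists_degree_split hw
    change G (monomial (u + v) 1) = F (monomial (u + v) 1)
    rw [show monomial (u + v) (1 : ℝ) = monomial u 1 * monomial v 1 by
      rw [monomial_mul, one_mul], hG, map_mul, Module.End.mul_apply,
      hcyc _ (monomial_mem_polyLE_of_degree_le hv),
      hform _ (monomial_mem_polyLE_of_degree_le hu)]
  · obtain ⟨⟨p', hp'⟩, h⟩ := hsurj (ψ p (N.mkQ ⟨1, h1U⟩))
    refine ⟨p', hp', fun q => ?_⟩
    rw [hG, map_mul, Module.End.mul_apply, map_sub, LinearMap.sub_apply, ← h, hcyc p' (hWU hp'),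
      hf, sub_self, map_zero, map_zero]

theorem xi_eq_of_isFlat {n : ℕ} {A : Matrix (Fin n) (Fin n) ℝ} {t : ℕ∞} (ht : 1 ≤ t)
    (hne : (values A ⊤).Nonempty) {L : TruncFunctional n t} (hL : IsFeasible A L)
    (hopt : mass L = xi A t) (hflat : IsFlat L) : xi A t = xi A ⊤ := by
  refine (xi_mono ht le_top hne).antisymm ?_
  cases t with
  | top => rfl
  | coe t =>
    obtain ⟨m, rfl⟩ : ∃ m, t = m + 1 := Nat.exists_eq_add_of_le' (by exact_mod_cast ht)
    obtain ⟨F, rfl, h1, h2⟩ := hL.exists_extend ht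
    obtain ⟨G, hG1, hG2⟩ := exists_flat_extension F fun p hp => hflat.exists_reduction hp
    rw [← hopt]
    refine csInf_le (values_bddBelow A le_top) ((mem_values_iff le_top).mpr
      ⟨G, fun g hg p _ => ?_, fun i j => ?_, (hG1 1 (one_mem_polyLE _ _)).symm⟩)
    -- Replacing `p` by its reduction `p'` changes `g * p ^ 2` by a multiple of `p - p'`, which `G`
    -- kills. As `p'` has degree at most `m` and `g` at most `2`, the product `g * p' ^ 2` falls in
    -- the range where `G = F`.
    · obtain ⟨p', hp', h⟩ := hG2 p
      have hd := degree_mul_sq_le (totalDegree_le_two_of_mem hg) (t := ((m + 1 : ℕ) : ℕ∞)) (p := p')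
        (by
          have : p'.totalDegree ≤ m := Nat.cast_le.mp (mem_polyLE.mp hp')
          exact_mod_cast Nat.succ_le_succ this)
      have e : g * p ^ 2 = g * p' ^ 2 + g * (p + p') * (p - p') := by ring
      rw [e, map_add, h, add_zero, hG1 _ hd]
      exact h1 g hg p' hd
    · rw [hG1 _ (X_mul_X_mem_polyLE ht i j)]
      exact h2 i j

end CPHierarchy

end

theorem proposition5 {n : ℕ} (A : Matrix (Fin n) (Fin n) ℝ) (hA : IsCompletelyPositive A) :
    -- the optima at the levels `t = 1, 2, …, ∞` and at level `*` are attained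
    (∀ t : ℕ∞, 1 ≤ t → IsLeast (values A t) (xi A t)) ∧
    IsLeast (valuesStar A) (xiStar A) ∧
    -- convergence
    Tendsto (fun t : ℕ => xi A (t : ℕ∞)) atTop (𝓝 (xi A ⊤)) ∧
    xi A ⊤ = xiStar A ∧
    -- a flat optimal solution certifies equality
    (∀ t : ℕ∞, 1 ≤ t →
      (∃ L : TruncFunctional n t, IsFeasible A L ∧ mass L = xi A t ∧ IsFlat L) →
      xi A t = xi A ⊤) ∧
    -- reformulation through point evaluations
    IsLeast (conicValues A) (xi A ⊤) := by
  have hne : (values A ⊤).Nonempty := by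
    rw [values_top_eq_conicValues]
    exact hA.conicValues_nonempty
  have hstar : xi A ⊤ = xiStar A := by rw [xi, xiStar, values_top_eq_valuesStar]
  have htop : IsLeast (values A ⊤) (xi A ⊤) := isLeast_xi le_top hne
  refine ⟨fun t ht => isLeast_xi ht (hne.mono (values_anti A ht le_top)), ?_, tendsto_xi hne,
    hstar, ?_, ?_⟩
  · rwa [← hstar, ← values_top_eq_valuesStar]
  · rintro t ht ⟨L, hL, hopt, hflat⟩
    exact xi_eq_of_isFlat ht hne hL hopt hflat
  · rwa [← values_top_eq_conicValues]
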